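/- **Model.** A principal and agents $1,\dots,n$ ($n\ge 1$). The incentive graph $G$ and the synergy graph $\widetilde G$ on $\{1,\dots,n\}$ have symmetric adjacency matrices $(g_{ij})$, $(\tilde g_{ij})$ with zero diagonal and entries in $\{0,1\}$ (or, more generally, edge weights in $[0,1]$). The local states $x_1,\dots,x_n$ are independent $N(\mu,\sigma^2)$, $\sigma>0$; let $\beta\ge 0$. At the action profile $a\in\mathbb R^n$ agent $i$ has payoff $u_i(a,x)=-(a_i-x_i)^2-\beta\sum_j g_{ij}(a_i-a_j)^2$ and the principal has payoff $v(a,x)=-\sum_i(a_i-x_i)^2-\beta\sum_{i,j}\tilde g_{ij}(a_i-a_j)^2$. The principal chooses a public signal, that is, a Markov kernel $\varphi$ from $\mathbb R^n$ to a measurable space $M$. The agents observe the realization $m$ and play a Nash equilibrium $a^*(m)$ for their common posterior about $x$. A signal is optimal if it maximizes $\mathbb E[v(a^*(m),x)]$ among all public signals. A signal informs the agents of a variable $y$ if $\mathbb E[y\mid m]=y$ almost surely. Optimal signals need not be unique; call an optimal signal maximal if it informs the agents of every linear statistic $c'x$ ($c\in\mathbb R^n$) of which some optimal signal informs them. **Proposition.**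 Suppose that the synergy graph is complete, $\tilde g_{ij}=1$ for all $i\ne j$. Let $q_1=\mathbf 1_n,q_2,\dots,q_n$ be pairwise orthogonal nonzero eigenvectors of the Laplacian matrix $L$ of $G$, with eigenvalues $\lambda_1=0,\lambda_2,\dots,\lambda_n$, and let $m_j=q_j'x$. Read $1/\beta=\infty$ if $\beta=0$. 1. The signal that discloses exactly $m_1$ and those $m_j$, $j\ge 2$, with $1/\beta\ge 2(n-\lambda_j)$ is optimal, and it is maximal. 2. Every maximal optimal signal informs the agents of $m_1$ and, for $j\ge 2$, it informs them of $m_j$ if and only if $1/\beta\ge 2(n-\lambda_j)$. Almost surely, the posterior expectation of $x$ that it induces equals the posterior expectation of $x$ given exactly those of $m_1,\dots,m_n$ of which it informs them. 3. Every optimal signal, maximal or not, informs the agents of $m_1$. For $j\ge 2$, if it informs them of $m_j$ then $1/\beta\ge 2(n-\lambda_j)$, and if $1/\beta>2(n-\lambda_j)$ then it informs them of $m_j$. -/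

import Mathlib

open MeasureTheory ProbabilityTheory
open scoped NNReal Matrix

universe u v

/-- An organization with `n` agents. `incentive` and `synergy` are the adjacency matrices of the
incentive graph and of the synergy graph; edge weights in `[0, 1]` are allowed, unweighted graphs
being the case where all weights are `0` or `1`. `β` is the importance of coordination; the local
states are independent, normal, with mean `μ` and standard deviation `σ > 0`. -/
structure Organization (n : ℕ) where
  incentive : Matrix (Fin n) (Fin n) ℝ
  synergy : Matrix (Fin n) (Fin n) ℝ
  incentive_symm : ∀ i j, incentive i j = incentive j i
  incentive_diag : ∀ i, incentive i i = 0
  incentive_mem : ∀ i j, incentive i j ∈ Set.Icc (0 : ℝ) 1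
  synergy_symm : ∀ i j, synergy i j = synergy j i
  synergy_diag : ∀ i, synergy i i = 0
  synergy_mem : ∀ i j, synergy i j ∈ Set.Icc (0 : ℝ) 1
  β : ℝ
  β_nonneg : 0 ≤ β
  μ : ℝ
  σ : ℝ≥0
  σ_pos : 0 < σ

namespace Organization

variable {n : ℕ} (O : Organization n)

/-- The Laplacian matrix of the incentive graph. -/
def laplacian : Matrix (Fin n) (Fin n) ℝ :=
  Matrix.of fun i j => if i = j then ∑ k, O.incentive i k else -O.incentive i j

/-- The prior law of the vector of local states, `N(μ 1, σ² I)`. -/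
noncomputable def prior : Measure (Fin n → ℝ) :=
  Measure.pi fun _ => gaussianReal O.μ (O.σ ^ 2)

noncomputable instance : IsProbabilityMeasure O.prior := by
  unfold prior; infer_instance

/-- The payoff of agent `i` at the action profile `a` and the state `x`. -/
def agentPayoff (i : Fin n) (a x : Fin n → ℝ) : ℝ :=
  -(a i - x i) ^ 2 - O.β * ∑ j, O.incentive i j * (a i - a j) ^ 2

/-- The payoff of the principal at the action profile `a` and the state `x`. -/
def principalPayoff (a x : Fin n → ℝ) : ℝ :=
  -(∑ i, (a i - x i) ^ 2) - O.β * ∑ i, ∑ j, O.synergy i j * (a i - a j) ^ 2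

section Signals

/-! A public signal is a Markov kernel from states to a measurable space `M` of realizations. -/

variable {M : Type u} [MeasurableSpace M] (φ : Kernel (Fin n → ℝ) M) [IsMarkovKernel φ]

/-- The joint law of the state and the signal realization. -/
noncomputable def joint : Measure ((Fin n → ℝ) × M) := O.prior ⊗ₘ φ

/-- The law of the signal realization. -/
noncomputable def signalLaw : Measure M := φ ∘ₘ O.prior

/-- The common posterior belief about the state after a signal realization. -/
noncomputable def belief : Kernel M (Fin n → ℝ) := posterior φ O.prior

/-- The posterior expectation of the vector of local states after the realization `m`. -/
noncomputable def posteriorMean (m : M) : Fin n → ℝ := fun i => ∫ x, x i ∂(O.belief φ m)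

/-- The signal informs the agents of the variable `y`: almost surely `E[y | m] = y`. -/
def Informs (y : (Fin n → ℝ) → ℝ) : Prop :=
  Integrable y O.prior ∧ ∀ᵐ p ∂(O.joint φ), ∫ x, y x ∂(O.belief φ p.2) = y p.1

/-- A profile `s` of strategies (actions as functions of the public signal) is a Nash equilibrium:
after almost every realization, no agent can gain in expectation under the common posterior by
deviating to another action. -/
def IsEquilibrium (s : M → Fin n → ℝ) : Prop :=
  Measurable s ∧ ∀ᵐ m ∂(O.signalLaw φ), ∀ (i : Fin n) (d : ℝ),
    ∫ x, O.agentPayoff i (Function.update (s m) i d) x ∂(O.belief φ m) ≤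
      ∫ x, O.agentPayoff i (s m) x ∂(O.belief φ m)

/-- The expected payoff of the principal when the agents play `s`. -/
noncomputable def value (s : M → Fin n → ℝ) : ℝ :=
  ∫ p, O.principalPayoff (s p.2) p.1 ∂(O.joint φ)

/-- The signal maximizes the expected equilibrium payoff of the principal among all public
signals, with arbitrary measurable spaces of realizations. -/
def IsOptimal : Prop :=
  ∃ s : M → Fin n → ℝ, O.IsEquilibrium φ s ∧
    ∀ (M' : Type v) [MeasurableSpace M'] (ψ : Kernel (Fin n → ℝ) M') [IsMarkovKernel ψ]
      (t : M' → Fin n → ℝ), O.IsEquilibrium ψ t → O.value ψ t ≤ O.value φ s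

/-- An optimal signal for which ties are broken in favour of disclosure: it informs the agents of
every linear statistic of the state of which some optimal signal informs them. -/
def IsMaximalOptimal : Prop :=
  IsOptimal.{u, v} O φ ∧
    ∀ (M' : Type v) [MeasurableSpace M'] (ψ : Kernel (Fin n → ℝ) M') [IsMarkovKernel ψ],
      IsOptimal.{v, v} O ψ → ∀ c : Fin n → ℝ,
        O.Informs ψ (fun x => c ⬝ᵥ x) → O.Informs φ (fun x => c ⬝ᵥ x)

end Signals

end Organization

/-- The public signal that discloses exactly the linear statistics `q j ⬝ᵥ x` with `j ∈ S`. -/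
noncomputable def discloseStatistics {n : ℕ} (q : Fin n → Fin n → ℝ) (S : Set (Fin n)) :
    Kernel (Fin n → ℝ) (S → ℝ) :=
  Kernel.deterministic (fun x j => q j ⬝ᵥ x) (by
    refine measurable_pi_lambda _ fun j => ?_
    unfold dotProduct
    fun_prop)

instance {n : ℕ} (q : Fin n → Fin n → ℝ) (S : Set (Fin n)) :
    IsMarkovKernel (discloseStatistics q S) := by
  unfold discloseStatistics; infer_instance

/-! Write `x̂` for the posterior mean. First-order conditions turn equilibrium into the linear
system `(I + βL) a = x̂`, so along the eigenvector `q j` the action is `q j ⬝ᵥ x̂` divided by `1 + β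
λ_j`. The complete synergy graph has Laplacian `n I - 11'`, which is diagonal in the same basis
because that basis contains `1`. The expected payoff therefore separates (`value_eq`): up to a
constant it is the sum over `j` of `weight j / |q j|²` times `E[(q j ⬝ᵥ x̂)²]`.

As `x̂` is an orthogonal projection of the state, each second moment lies between `0` and `E[(q j ⬝ᵥ
x)²]`. The upper end is attained exactly when the signal informs of `q j ⬝ᵥ x`, the lower end
exactly when the estimate vanishes. All the desired extremes are attained at once: orthogonal
statistics of the Gaussian state are independent, so disclosing some reveals nothing about the
others, and those other than the first have mean zero. This yields `isOptimal_iff`: positive weights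
force disclosure, negative weights force a zero estimate, zero weights force nothing. The sign of
the weight is that of `1 - 2β(n - λ_j)` for `j ≠ z`, and the first weight is `1`.

For maximality, a statistic `c ⬝ᵥ x` of which an optimal signal informs has `c` orthogonal to every
`q k` of negative weight (`dotProduct_eq_zero_of_informs`), so disclosing all nonnegative weights
also reveals it. -/

namespace Organization

variable {n : ℕ} (O : Organization n)

/-! ### Moments and independence of linear statistics under the Gaussian prior -/

section Prior

lemma measurable_dotProduct_left (c : Fin n → ℝ) : Measurable fun x : Fin n → ℝ => c ⬝ᵥ x := by
  unfold dotProduct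
  fun_prop

lemma measurePreserving_eval_prior (i : Fin n) :
    MeasurePreserving (fun x : Fin n → ℝ => x i) O.prior (gaussianReal O.μ (O.σ ^ 2)) :=
  measurePreserving_eval (fun _ : Fin n => gaussianReal O.μ (O.σ ^ 2)) i

lemma memLp_coord_prior (i : Fin n) : MemLp (fun x : Fin n → ℝ => x i) 2 O.prior :=
  (memLp_id_gaussianReal' 2 (by simp)).comp_measurePreserving (O.measurePreserving_eval_prior i)

lemma memLp_dotProduct {Ω : Type*} [MeasurableSpace Ω] {P : Measure Ω} {X : Ω → Fin n → ℝ}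
    (hX : ∀ i, MemLp (fun ω => X ω i) 2 P) (c : Fin n → ℝ) :
    MemLp (fun ω => c ⬝ᵥ X ω) 2 P := by
  unfold dotProduct
  exact memLp_finsetSum _ fun i _ => (hX i).const_mul (c i)

lemma memLp_dotProduct_prior (c : Fin n → ℝ) : MemLp (fun x => c ⬝ᵥ x) 2 O.prior :=
  memLp_dotProduct O.memLp_coord_prior c

lemma integral_coord_prior (i : Fin n) : ∫ x, x i ∂O.prior = O.μ := by
  have h := (O.measurePreserving_eval_prior i).map_eq
  have h2 := integral_map (μ := O.prior) (φ := fun x : Fin n → ℝ => x i)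
    (measurable_pi_apply i).aemeasurable (f := fun y : ℝ => y) (by fun_prop)
  rw [← h2, h, integral_id_gaussianReal]

lemma integral_dotProduct_prior (c : Fin n → ℝ) :
    ∫ x, c ⬝ᵥ x ∂O.prior = O.μ * (c ⬝ᵥ 1) := by
  simp only [dotProduct]
  rw [integral_finsetSum _ fun i _ => ((O.memLp_coord_prior i).integrable one_le_two).const_mul _]
  simp [integral_const_mul, integral_coord_prior, Finset.mul_sum, mul_comm]

lemma iIndepFun_coord_prior : iIndepFun (fun (i : Fin n) (x : Fin n → ℝ) => x i) O.prior :=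
  iIndepFun_pi (μ := fun _ : Fin n => gaussianReal O.μ (O.σ ^ 2)) (X := fun _ => id)
    fun _ => aemeasurable_id

lemma covariance_coord_prior (i j : Fin n) :
    cov[fun x => x i, fun x => x j; O.prior] = if i = j then (O.σ : ℝ) ^ 2 else 0 := by
  split_ifs with h
  · subst h
    rw [covariance_self (measurable_pi_apply i).aemeasurable]
    have h1 := (O.measurePreserving_eval_prior i).map_eq
    have h2 := variance_map (μ := O.prior) (Y := fun x : Fin n → ℝ => x i) (X := id)
      aemeasurable_id (measurable_pi_apply i).aemeasurable
    rw [h1, variance_id_gaussianReal] at h2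
    simpa [Function.comp_def] using h2.symm
  · exact (O.iIndepFun_coord_prior.indepFun h).covariance_eq_zero (O.memLp_coord_prior i)
      (O.memLp_coord_prior j)

lemma covariance_dotProduct_prior (c d : Fin n → ℝ) :
    cov[fun x => c ⬝ᵥ x, fun x => d ⬝ᵥ x; O.prior] = (O.σ : ℝ) ^ 2 * (c ⬝ᵥ d) := by
  simp only [dotProduct]
  rw [covariance_fun_sum_fun_sum (fun i => (O.memLp_coord_prior i).const_mul _)
    (fun i => (O.memLp_coord_prior i).const_mul _)]
  simp only [covariance_const_mul_left, covariance_const_mul_right, covariance_coord_prior,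
    Finset.mul_sum]
  refine Finset.sum_congr rfl fun i _ => ?_
  simp
  ring

lemma integral_dotProduct_mul_dotProduct_prior (c d : Fin n → ℝ) :
    ∫ x, (c ⬝ᵥ x) * (d ⬝ᵥ x) ∂O.prior =
      (O.σ : ℝ) ^ 2 * (c ⬝ᵥ d) + O.μ ^ 2 * (c ⬝ᵥ 1) * (d ⬝ᵥ 1) := by
  have h := covariance_eq_sub (O.memLp_dotProduct_prior c) (O.memLp_dotProduct_prior d)
  rw [covariance_dotProduct_prior, integral_dotProduct_prior, integral_dotProduct_prior] at h
  have h' : ∫ x, (c ⬝ᵥ x) * (d ⬝ᵥ x) ∂O.prior = O.prior[(fun x => c ⬝ᵥ x) * fun x => d ⬝ᵥ x] := rfl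
  rw [h']
  linarith

lemma hasGaussianLaw_prior : HasGaussianLaw (fun x : Fin n → ℝ => x) O.prior := by
  refine iIndepFun.hasGaussianLaw (X := fun (i : Fin n) (x : Fin n → ℝ) => x i) (fun i => ?_)
    O.iIndepFun_coord_prior
  exact ⟨by rw [(O.measurePreserving_eval_prior i).map_eq]; infer_instance⟩

/-- Linear statistics with orthogonal coefficients are independent under the prior. -/
lemma indepFun_statistics {ι : Type*} [Finite ι] (q : ι → Fin n → ℝ) (c : Fin n → ℝ)
    (h : ∀ i, q i ⬝ᵥ c = 0) :
    IndepFun (fun x i => q i ⬝ᵥ x) (fun x => c ⬝ᵥ x) O.prior := by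
  have := Fintype.ofFinite ι
  -- Both families form one linear image of the Gaussian state, so they are jointly Gaussian and
  -- zero covariance gives independence. The index `Unit` presents the single statistic as a family.
  let A : (Fin n → ℝ) →ₗ[ℝ] (ι → ℝ) × (Unit → ℝ) :=
    (Matrix.mulVecLin (Matrix.of q)).prod (Matrix.mulVecLin (Matrix.of fun _ : Unit => c))
  have hA : HasGaussianLaw
      (fun x : Fin n → ℝ => ((fun i => q i ⬝ᵥ x), fun _ : Unit => c ⬝ᵥ x)) O.prior :=
    O.hasGaussianLaw_prior.map_fun A.toContinuousLinearMap
  have h2 := hA.indepFun_of_covariance_eval (X := fun i x => q i ⬝ᵥ x)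
    (Y := fun _ : Unit => fun x => c ⬝ᵥ x) fun i _ => by
      rw [covariance_dotProduct_prior, h, mul_zero]
  exact h2.comp (φ := id) (ψ := fun f : Unit → ℝ => f ()) measurable_id (by fun_prop)

end Prior

/-! ### The posterior mean as an `L²` projection -/

section Joint

variable {M : Type u} [MeasurableSpace M] (φ : Kernel (Fin n → ℝ) M) [IsMarkovKernel φ]

instance : IsProbabilityMeasure (O.joint φ) := by unfold joint; infer_instance

instance : IsProbabilityMeasure (O.signalLaw φ) := by unfold signalLaw; infer_instance

instance : IsMarkovKernel (O.belief φ) := by unfold belief; infer_instance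

lemma measurePreserving_fst_joint : MeasurePreserving Prod.fst (O.joint φ) O.prior :=
  ⟨measurable_fst, Measure.fst_compProd _ _⟩

lemma measurePreserving_snd_joint : MeasurePreserving Prod.snd (O.joint φ) (O.signalLaw φ) :=
  ⟨measurable_snd, Measure.snd_compProd _ _⟩

lemma measurePreserving_swap_joint :
    MeasurePreserving Prod.swap (O.joint φ) (O.signalLaw φ ⊗ₘ O.belief φ) :=
  ⟨measurable_swap, compProd_posterior_eq_map_swap.symm⟩

lemma measurePreserving_swap_belief :
    MeasurePreserving Prod.swap (O.signalLaw φ ⊗ₘ O.belief φ) (O.joint φ) := by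
  refine ⟨measurable_swap, ?_⟩
  rw [← (O.measurePreserving_swap_joint φ).map_eq, Measure.map_map measurable_swap measurable_swap,
    Prod.swap_swap_eq, Measure.map_id]

lemma integral_joint_eq {F : (Fin n → ℝ) × M → ℝ} (hF : Integrable F (O.joint φ)) :
    ∫ p, F p ∂O.joint φ = ∫ m, ∫ x, F (x, m) ∂O.belief φ m ∂O.signalLaw φ := by
  have h := O.measurePreserving_swap_belief φ
  have h2 := h.integrable_comp_of_integrable hF
  rw [← h.integral_comp MeasurableEquiv.prodComm.measurableEmbedding F]
  exact Measure.integral_compProd h2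

lemma ae_integrable_belief {f : (Fin n → ℝ) → ℝ} (hf : Integrable f O.prior) :
    ∀ᵐ m ∂O.signalLaw φ, Integrable f (O.belief φ m) := by
  have h1 : Integrable (fun p : (Fin n → ℝ) × M => f p.1) (O.joint φ) :=
    (O.measurePreserving_fst_joint φ).integrable_comp_of_integrable hf
  have h2 := (O.measurePreserving_swap_belief φ).integrable_comp_of_integrable h1
  exact ((Measure.integrable_compProd_iff h2.1).1 h2).1

lemma integrable_integral_belief {f : (Fin n → ℝ) → ℝ} (hf : Integrable f O.prior) :
    Integrable (fun m => ∫ x, f x ∂O.belief φ m) (O.signalLaw φ) := by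
  have h1 : Integrable (fun p : (Fin n → ℝ) × M => f p.1) (O.joint φ) :=
    (O.measurePreserving_fst_joint φ).integrable_comp_of_integrable hf
  have h2 := (O.measurePreserving_swap_belief φ).integrable_comp_of_integrable h1
  rw [Measure.compProd] at h2
  simpa using h2.integral_compProd

lemma ae_memLp_coord_belief :
    ∀ᵐ m ∂O.signalLaw φ, ∀ i, MemLp (fun x : Fin n → ℝ => x i) 2 (O.belief φ m) := by
  rw [ae_all_iff]
  intro i
  filter_upwards [O.ae_integrable_belief φ (O.memLp_coord_prior i).integrable_sq] with m hm
  exact (memLp_two_iff_integrable_sq (measurable_pi_apply i).aestronglyMeasurable).2 hm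

lemma measurable_posteriorMean : Measurable (O.posteriorMean φ) := by
  refine measurable_pi_lambda _ fun i => ?_
  exact (StronglyMeasurable.integral_kernel (κ := O.belief φ) (f := fun x : Fin n → ℝ => x i)
    (measurable_pi_apply i).stronglyMeasurable).measurable

/-- Jensen's inequality, in the form that the variance under each belief is nonnegative. -/
lemma memLp_posteriorMean (i : Fin n) :
    MemLp (fun m => O.posteriorMean φ m i) 2 (O.signalLaw φ) := by
  have hmeas : Measurable fun m => O.posteriorMean φ m i :=
    (measurable_pi_apply i).comp (O.measurable_posteriorMean φ)
  rw [memLp_two_iff_integrable_sq hmeas.aestronglyMeasurable]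
  refine (O.integrable_integral_belief φ (O.memLp_coord_prior i).integrable_sq).mono'
    (hmeas.pow_const 2).aestronglyMeasurable ?_
  filter_upwards [O.ae_memLp_coord_belief φ] with m hm
  have h := variance_nonneg (fun x : Fin n → ℝ => x i) (O.belief φ m)
  rw [variance_eq_sub (hm i)] at h
  rw [Real.norm_of_nonneg (sq_nonneg _)]
  simpa [posteriorMean] using h

/-- The exceptional null set comes from the coordinates alone, so one set serves all `c`. -/
lemma ae_integral_dotProduct_belief :
    ∀ᵐ m ∂O.signalLaw φ, ∀ c : Fin n → ℝ,
      ∫ x, c ⬝ᵥ x ∂O.belief φ m = c ⬝ᵥ O.posteriorMean φ m := by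
  filter_upwards [O.ae_memLp_coord_belief φ] with m hm c
  simp only [dotProduct]
  rw [integral_finsetSum _ fun i _ => ((hm i).integrable one_le_two).const_mul _]
  simp [integral_const_mul, posteriorMean]

lemma memLp_state (c : Fin n → ℝ) :
    MemLp (fun p : (Fin n → ℝ) × M => c ⬝ᵥ p.1) 2 (O.joint φ) :=
  (O.memLp_dotProduct_prior c).comp_measurePreserving (O.measurePreserving_fst_joint φ)

lemma memLp_posteriorMean_dotProduct (c : Fin n → ℝ) :
    MemLp (fun m => c ⬝ᵥ O.posteriorMean φ m) 2 (O.signalLaw φ) :=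
  memLp_dotProduct (O.memLp_posteriorMean φ) c

lemma memLp_estimate (c : Fin n → ℝ) :
    MemLp (fun p : (Fin n → ℝ) × M => c ⬝ᵥ O.posteriorMean φ p.2) 2 (O.joint φ) :=
  (O.memLp_posteriorMean_dotProduct φ c).comp_measurePreserving (O.measurePreserving_snd_joint φ)

/-- The posterior mean is the orthogonal projection of the state on functions of the signal. -/
lemma integral_mul_state {h : M → ℝ} (hh : MemLp h 2 (O.signalLaw φ)) (c : Fin n → ℝ) :
    ∫ p, h p.2 * (c ⬝ᵥ p.1) ∂O.joint φ =
      ∫ p, h p.2 * (c ⬝ᵥ O.posteriorMean φ p.2) ∂O.joint φ := by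
  have hh' : MemLp (fun p : (Fin n → ℝ) × M => h p.2) 2 (O.joint φ) :=
    hh.comp_measurePreserving (O.measurePreserving_snd_joint φ)
  have h1 : Integrable (fun p => h p.2 * (c ⬝ᵥ p.1)) (O.joint φ) :=
    hh'.integrable_mul (O.memLp_state φ c)
  have h2 : Integrable (fun p => h p.2 * (c ⬝ᵥ O.posteriorMean φ p.2)) (O.joint φ) :=
    hh'.integrable_mul (O.memLp_estimate φ c)
  rw [O.integral_joint_eq φ h1, O.integral_joint_eq φ h2]
  refine integral_congr_ae ?_
  filter_upwards [O.ae_integral_dotProduct_belief φ] with m hm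
  simp [integral_const_mul, hm c]

lemma integral_estimate_mul_state (c d : Fin n → ℝ) :
    ∫ p, (c ⬝ᵥ O.posteriorMean φ p.2) * (d ⬝ᵥ p.1) ∂O.joint φ =
      ∫ p, (c ⬝ᵥ O.posteriorMean φ p.2) * (d ⬝ᵥ O.posteriorMean φ p.2) ∂O.joint φ :=
  O.integral_mul_state φ (O.memLp_posteriorMean_dotProduct φ c) d

lemma integral_state_mul_state (c d : Fin n → ℝ) :
    ∫ p, (c ⬝ᵥ p.1) * (d ⬝ᵥ p.1) ∂O.joint φ =
      (O.σ : ℝ) ^ 2 * (c ⬝ᵥ d) + O.μ ^ 2 * (c ⬝ᵥ 1) * (d ⬝ᵥ 1) := by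
  rw [← O.integral_dotProduct_mul_dotProduct_prior, ← (O.measurePreserving_fst_joint φ).map_eq,
    integral_map measurable_fst.aemeasurable]
  exact ((measurable_dotProduct_left c).mul (measurable_dotProduct_left d)).aestronglyMeasurable

/-- Pythagoras: the estimation error is orthogonal to the estimate. -/
lemma integral_sq_state_sub_estimate (c : Fin n → ℝ) :
    ∫ p, (c ⬝ᵥ p.1 - c ⬝ᵥ O.posteriorMean φ p.2) ^ 2 ∂O.joint φ =
      ∫ p, (c ⬝ᵥ p.1) ^ 2 ∂O.joint φ - ∫ p, (c ⬝ᵥ O.posteriorMean φ p.2) ^ 2 ∂O.joint φ := by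
  have h1 := (O.memLp_state φ c).integrable_sq
  have h2 := (O.memLp_estimate φ c).integrable_sq
  have h3 : Integrable (fun p => 2 * ((c ⬝ᵥ O.posteriorMean φ p.2) * (c ⬝ᵥ p.1))) (O.joint φ) :=
    ((O.memLp_estimate φ c).integrable_mul (O.memLp_state φ c)).const_mul 2
  have h4 := O.integral_estimate_mul_state φ c c
  have h5 : ∀ p : (Fin n → ℝ) × M, (c ⬝ᵥ p.1 - c ⬝ᵥ O.posteriorMean φ p.2) ^ 2 =
      (c ⬝ᵥ p.1) ^ 2 + (c ⬝ᵥ O.posteriorMean φ p.2) ^ 2 -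
        2 * ((c ⬝ᵥ O.posteriorMean φ p.2) * (c ⬝ᵥ p.1)) := fun p => by ring
  simp_rw [h5]
  rw [integral_sub (by exact h1.add h2) h3, integral_add h1 h2, integral_const_mul, h4]
  simp_rw [← pow_two]
  ring

lemma estimate_eq_state_iff (c : Fin n → ℝ) :
    (∀ᵐ p ∂O.joint φ, c ⬝ᵥ O.posteriorMean φ p.2 = c ⬝ᵥ p.1) ↔
      ∫ p, (c ⬝ᵥ O.posteriorMean φ p.2) ^ 2 ∂O.joint φ = ∫ p, (c ⬝ᵥ p.1) ^ 2 ∂O.joint φ := by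
  have h := integral_eq_zero_iff_of_nonneg (μ := O.joint φ)
    (f := fun p => (c ⬝ᵥ p.1 - c ⬝ᵥ O.posteriorMean φ p.2) ^ 2) (fun p => sq_nonneg _)
    ((O.memLp_state φ c).sub (O.memLp_estimate φ c)).integrable_sq
  rw [O.integral_sq_state_sub_estimate, sub_eq_zero, eq_comm] at h
  rw [h]
  refine Filter.eventually_congr (.of_forall fun p => ?_)
  simp only [Pi.zero_apply, sq_eq_zero_iff, sub_eq_zero]
  exact eq_comm

lemma estimate_eq_zero_iff (c : Fin n → ℝ) :
    (∀ᵐ p ∂O.joint φ, c ⬝ᵥ O.posteriorMean φ p.2 = 0) ↔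
      ∫ p, (c ⬝ᵥ O.posteriorMean φ p.2) ^ 2 ∂O.joint φ = 0 := by
  rw [integral_eq_zero_iff_of_nonneg (fun p => sq_nonneg _) (O.memLp_estimate φ c).integrable_sq]
  refine Filter.eventually_congr (.of_forall fun p => ?_)
  simp

lemma integral_sq_estimate_le (c : Fin n → ℝ) :
    ∫ p, (c ⬝ᵥ O.posteriorMean φ p.2) ^ 2 ∂O.joint φ ≤ ∫ p, (c ⬝ᵥ p.1) ^ 2 ∂O.joint φ := by
  have h := O.integral_sq_state_sub_estimate φ c
  have h2 : 0 ≤ ∫ p, (c ⬝ᵥ p.1 - c ⬝ᵥ O.posteriorMean φ p.2) ^ 2 ∂O.joint φ :=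
    integral_nonneg fun p => sq_nonneg _
  linarith

lemma informs_dotProduct_iff (c : Fin n → ℝ) :
    O.Informs φ (fun x => c ⬝ᵥ x) ↔
      ∀ᵐ p ∂O.joint φ, c ⬝ᵥ O.posteriorMean φ p.2 = c ⬝ᵥ p.1 := by
  unfold Informs
  rw [and_iff_right ((O.memLp_dotProduct_prior c).integrable one_le_two)]
  refine Filter.eventually_congr ?_
  filter_upwards [(O.measurePreserving_snd_joint φ).quasiMeasurePreserving.ae
    (O.ae_integral_dotProduct_belief φ)] with p hp
  rw [hp]

end Joint

/-! ### Estimates under deterministic signals -/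

section Disclosure

variable {N : Type u} [MeasurableSpace N] {g : (Fin n → ℝ) → N} (hg : Measurable g)

lemma joint_deterministic :
    O.joint (Kernel.deterministic g hg) = O.prior.map fun x => (x, g x) :=
  Measure.compProd_deterministic hg

/-- A deterministic signal that determines a statistic informs the agents of it. -/
lemma estimate_deterministic_eq_state (c : Fin n → ℝ) {h : N → ℝ} (hh : Measurable h)
    (hc : ∀ x, h (g x) = c ⬝ᵥ x) :
    ∀ᵐ p ∂O.joint (Kernel.deterministic g hg),
      c ⬝ᵥ O.posteriorMean (Kernel.deterministic g hg) p.2 = c ⬝ᵥ p.1 := by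
  set φ := Kernel.deterministic g hg
  have hae : ∀ᵐ p ∂O.joint φ, h p.2 = c ⬝ᵥ p.1 := by
    rw [O.joint_deterministic hg]
    refine (ae_map_iff (measurable_id.prodMk hg).aemeasurable
      (measurableSet_eq_fun (hh.comp measurable_snd)
        ((measurable_dotProduct_left c).comp measurable_fst))).2 (.of_forall hc)
  have hL : MemLp (fun p : (Fin n → ℝ) × N => h p.2) 2 (O.joint φ) :=
    (memLp_congr_ae hae).2 (O.memLp_state φ c)
  -- Square integrability makes `h` an admissible test function for the projection property; testing
  -- against it equates the second moments of estimate and state.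
  have hL' : MemLp h 2 (O.signalLaw φ) := by
    rw [← (O.measurePreserving_snd_joint φ).map_eq,
      memLp_map_measure_iff hh.aestronglyMeasurable measurable_snd.aemeasurable]
    exact hL
  rw [O.estimate_eq_state_iff]
  have h1 := O.integral_mul_state φ hL' c
  have h2 : ∫ p, h p.2 * (c ⬝ᵥ p.1) ∂O.joint φ = ∫ p, (c ⬝ᵥ p.1) ^ 2 ∂O.joint φ :=
    integral_congr_ae (by filter_upwards [hae] with p hp; rw [hp, pow_two])
  have h3 : ∫ p, h p.2 * (c ⬝ᵥ O.posteriorMean φ p.2) ∂O.joint φ =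
      ∫ p, (c ⬝ᵥ O.posteriorMean φ p.2) * (c ⬝ᵥ p.1) ∂O.joint φ :=
    integral_congr_ae (by filter_upwards [hae] with p hp; rw [hp, mul_comm])
  rw [← h2, h1, h3, O.integral_estimate_mul_state]
  simp_rw [pow_two]
  rfl

/-- A deterministic signal that is independent of a centred statistic does not move its posterior
expectation. -/
lemma estimate_deterministic_eq_zero (c : Fin n → ℝ)
    (hind : IndepFun g (fun x => c ⬝ᵥ x) O.prior) (hc : c ⬝ᵥ 1 = 0) :
    ∀ᵐ p ∂O.joint (Kernel.deterministic g hg),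
      c ⬝ᵥ O.posteriorMean (Kernel.deterministic g hg) p.2 = 0 := by
  set φ := Kernel.deterministic g hg
  have hmeas : Measurable fun m => c ⬝ᵥ O.posteriorMean φ m :=
    (measurable_dotProduct_left c).comp (O.measurable_posteriorMean φ)
  rw [O.estimate_eq_zero_iff]
  have h1 := O.integral_estimate_mul_state φ c c
  simp_rw [← pow_two] at h1
  rw [← h1, O.joint_deterministic hg,
    integral_map (φ := fun x => (x, g x)) (measurable_id.prodMk hg).aemeasurable]
  -- The estimate is a function of `g`, hence independent of the statistic; the expected product
  -- factors and one factor is the zero mean.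
  · have h2 := (hind.comp hmeas measurable_id).integral_fun_mul_eq_mul_integral
      (hmeas.comp hg).aestronglyMeasurable (measurable_dotProduct_left c).aestronglyMeasurable
    simp only [Function.comp_apply, id] at h2
    rw [h2, O.integral_dotProduct_prior, hc, mul_zero, mul_zero]
  · exact ((hmeas.comp measurable_snd).mul
      ((measurable_dotProduct_left c).comp measurable_fst)).aestronglyMeasurable

end Disclosure

/-! ### The Laplacian as a quadratic form -/

section Laplacian

lemma laplacian_mulVec (a : Fin n → ℝ) (i : Fin n) :
    (O.laplacian *ᵥ a) i = ∑ j, O.incentive i j * (a i - a j) := by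
  have h : ∀ j, O.laplacian i j * a j =
      (if i = j then (∑ k, O.incentive i k) * a j else 0) - O.incentive i j * a j := by
    intro j
    by_cases hij : i = j
    · subst hij
      simp [laplacian, O.incentive_diag]
    · simp [laplacian, hij]
  simp only [Matrix.mulVec, dotProduct, h, Finset.sum_sub_distrib, mul_sub, Finset.sum_ite_eq,
    Finset.mem_univ, if_true, Finset.sum_mul]

lemma laplacian_transpose : O.laplacianᵀ = O.laplacian := by
  ext i j
  by_cases hij : i = j
  · subst hij; rfl
  · simp [laplacian, hij, Ne.symm hij, O.incentive_symm i j]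

lemma dotProduct_laplacian_mulVec (a b : Fin n → ℝ) :
    a ⬝ᵥ (O.laplacian *ᵥ b) = (O.laplacian *ᵥ a) ⬝ᵥ b := by
  rw [Matrix.dotProduct_mulVec, ← Matrix.mulVec_transpose, laplacian_transpose]

/-- By symmetry of the weights the form can be written with `i` and `j` exchanged; adding the two
versions completes the square. -/
lemma two_mul_dotProduct_laplacian_mulVec (a : Fin n → ℝ) :
    2 * (a ⬝ᵥ (O.laplacian *ᵥ a)) = ∑ i, ∑ j, O.incentive i j * (a i - a j) ^ 2 := by
  have h1 : a ⬝ᵥ (O.laplacian *ᵥ a) = ∑ i, ∑ j, O.incentive i j * (a i * (a i - a j)) := by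
    simp only [dotProduct, laplacian_mulVec, Finset.mul_sum]
    exact Finset.sum_congr rfl fun i _ => Finset.sum_congr rfl fun j _ => by ring
  have h2 : a ⬝ᵥ (O.laplacian *ᵥ a) = ∑ i, ∑ j, O.incentive i j * (a j * (a j - a i)) := by
    rw [h1, Finset.sum_comm]
    exact Finset.sum_congr rfl fun i _ => Finset.sum_congr rfl fun j _ => by
      rw [O.incentive_symm]
  rw [two_mul]
  nth_rewrite 1 [h1]
  rw [h2, ← Finset.sum_add_distrib]
  refine Finset.sum_congr rfl fun i _ => ?_
  rw [← Finset.sum_add_distrib]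
  exact Finset.sum_congr rfl fun j _ => by ring

lemma dotProduct_laplacian_mulVec_nonneg (a : Fin n → ℝ) : 0 ≤ a ⬝ᵥ (O.laplacian *ᵥ a) := by
  have h := O.two_mul_dotProduct_laplacian_mulVec a
  have h2 : 0 ≤ ∑ i, ∑ j, O.incentive i j * (a i - a j) ^ 2 :=
    Finset.sum_nonneg fun i _ => Finset.sum_nonneg fun j _ =>
      mul_nonneg (O.incentive_mem i j).1 (sq_nonneg _)
  linarith

end Laplacian

/-! ### Equilibrium as a linear system -/

section BestResponse

/-- The expected payoff of agent `i` from the action `d` depends on the belief only through the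
first two moments of the local state. -/
lemma integral_agentPayoff_update {B : Measure (Fin n → ℝ)} [IsProbabilityMeasure B] {i : Fin n}
    (hB : MemLp (fun x => x i) 2 B) (a : Fin n → ℝ) (d : ℝ) :
    ∫ x, O.agentPayoff i (Function.update a i d) x ∂B =
      -d ^ 2 + 2 * d * ∫ x, x i ∂B - ∫ x, x i ^ 2 ∂B -
        O.β * ∑ j, O.incentive i j * (d - a j) ^ 2 := by
  -- Only the term `j = i` sees the update, and its weight is zero.
  have hsum : ∑ j, O.incentive i j * (d - Function.update a i d j) ^ 2 =
      ∑ j, O.incentive i j * (d - a j) ^ 2 := by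
    refine Finset.sum_congr rfl fun j _ => ?_
    by_cases hj : j = i
    · subst hj; simp [O.incentive_diag]
    · simp [hj]
  have h : ∀ x : Fin n → ℝ, O.agentPayoff i (Function.update a i d) x =
      2 * d * x i - x i ^ 2 + (-d ^ 2 - O.β * ∑ j, O.incentive i j * (d - a j) ^ 2) := by
    intro x
    simp only [agentPayoff, Function.update_self, hsum]
    ring
  have h1 : Integrable (fun x : Fin n → ℝ => 2 * d * x i) B :=
    (hB.integrable one_le_two).const_mul _
  simp_rw [h]
  rw [integral_add (by exact h1.sub hB.integrable_sq) (integrable_const _),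
    integral_sub h1 hB.integrable_sq, integral_const_mul]
  simp
  ring

/-- At the minimizer `t = -G / κ` the quadratic equals `-G² / κ`. -/
lemma eq_zero_of_forall_quadratic_nonneg {κ G : ℝ} (hκ : 0 < κ)
    (h : ∀ t : ℝ, 0 ≤ κ * t ^ 2 + 2 * t * G) : G = 0 := by
  have h1 := h (-G / κ)
  have h2 : κ * (-G / κ) ^ 2 + 2 * (-G / κ) * G = -(G ^ 2 / κ) := by field_simp; ring
  rw [h2] at h1
  have h3 : G ^ 2 / κ ≤ 0 := by linarith
  rw [div_le_iff₀ hκ, zero_mul] at h3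
  exact pow_eq_zero_iff two_ne_zero |>.1 (le_antisymm h3 (sq_nonneg G))

/-- The first-order condition characterizes the best responses. -/
lemma best_response_iff {B : Measure (Fin n → ℝ)} [IsProbabilityMeasure B] {i : Fin n}
    (hB : MemLp (fun x => x i) 2 B) (a : Fin n → ℝ) :
    (∀ d, ∫ x, O.agentPayoff i (Function.update a i d) x ∂B ≤ ∫ x, O.agentPayoff i a x ∂B) ↔
      a i + O.β * (O.laplacian *ᵥ a) i = ∫ x, x i ∂B := by
  have hexp : ∀ t, ∑ j, O.incentive i j * (a i + t - a j) ^ 2 =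
      ∑ j, O.incentive i j * (a i - a j) ^ 2 + 2 * t * (O.laplacian *ᵥ a) i +
        t ^ 2 * ∑ j, O.incentive i j := by
    intro t
    rw [laplacian_mulVec, Finset.mul_sum, Finset.mul_sum, ← Finset.sum_add_distrib,
      ← Finset.sum_add_distrib]
    exact Finset.sum_congr rfl fun j _ => by ring
  -- The loss from deviating by `t` is exactly quadratic with positive curvature, so the first-order
  -- condition is sufficient as well as necessary.
  have hdiff : ∀ t, ∫ x, O.agentPayoff i a x ∂B -
      ∫ x, O.agentPayoff i (Function.update a i (a i + t)) x ∂B =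
        (1 + O.β * ∑ j, O.incentive i j) * t ^ 2 +
          2 * t * (a i + O.β * (O.laplacian *ᵥ a) i - ∫ x, x i ∂B) := by
    intro t
    have h0 := O.integral_agentPayoff_update hB a (a i)
    rw [Function.update_eq_self] at h0
    rw [h0, O.integral_agentPayoff_update hB, hexp]
    ring
  have hκ : 0 < 1 + O.β * ∑ j, O.incentive i j := by
    have := mul_nonneg O.β_nonneg (Finset.sum_nonneg fun j (_ : j ∈ Finset.univ) =>
      (O.incentive_mem i j).1)
    linarith
  constructor
  · intro h
    refine sub_eq_zero.1 (eq_zero_of_forall_quadratic_nonneg hκ fun t => ?_)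
    rw [← hdiff]
    exact sub_nonneg.2 (h _)
  · intro h d
    have h1 := hdiff (d - a i)
    rw [h, sub_self, mul_zero, add_zero, add_sub_cancel] at h1
    have h2 := mul_nonneg hκ.le (sq_nonneg (d - a i))
    linarith

lemma isEquilibrium_iff {M : Type u} [MeasurableSpace M] (φ : Kernel (Fin n → ℝ) M)
    [IsMarkovKernel φ] (s : M → Fin n → ℝ) :
    O.IsEquilibrium φ s ↔ Measurable s ∧
      ∀ᵐ m ∂O.signalLaw φ, s m + O.β • (O.laplacian *ᵥ s m) = O.posteriorMean φ m := by
  refine and_congr_right fun _ => Filter.eventually_congr ?_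
  filter_upwards [O.ae_memLp_coord_belief φ] with m hm
  rw [funext_iff]
  refine forall_congr' fun i => ?_
  rw [O.best_response_iff (hm i)]
  simp [posteriorMean]

end BestResponse

/-- `q` is an orthogonal eigenbasis of the Laplacian whose member at `z` is the constant vector. -/
structure IsEigenbasis (q : Fin n → Fin n → ℝ) (lam : Fin n → ℝ) (z : Fin n) : Prop where
  first : q z = 1
  ne_zero : ∀ j, q j ≠ 0
  orth : ∀ i j, i ≠ j → q i ⬝ᵥ q j = 0
  eig : ∀ j, O.laplacian *ᵥ q j = lam j • q j

/-! ### Coordinates in the eigenbasis -/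

namespace IsEigenbasis

variable {O} {q : Fin n → Fin n → ℝ} {lam : Fin n → ℝ} {z : Fin n}

lemma normSq_pos (h : O.IsEigenbasis q lam z) (j : Fin n) : 0 < q j ⬝ᵥ q j := by
  have h1 : 0 ≤ q j ⬝ᵥ q j := Finset.sum_nonneg fun i _ => mul_self_nonneg _
  exact lt_of_le_of_ne h1 fun h0 => h.ne_zero j (dotProduct_self_eq_zero.1 h0.symm)

lemma normSq_first (h : O.IsEigenbasis q lam z) : q z ⬝ᵥ q z = n := by
  simp [h.first, dotProduct]

lemma dotProduct_one (h : O.IsEigenbasis q lam z) {j : Fin n} (hj : j ≠ z) : q j ⬝ᵥ 1 = 0 := by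
  rw [← h.first]
  exact h.orth j z hj

/-- Orthogonality gives a right inverse of the matrix with rows `q j`; the matrix is square, so this
is also a left inverse, which is the expansion. -/
lemma expansion (h : O.IsEigenbasis q lam z) (v : Fin n → ℝ) :
    v = ∑ j, ((q j ⬝ᵥ v) / (q j ⬝ᵥ q j)) • q j := by
  have h1 : Matrix.of q * ((Matrix.of q)ᵀ * Matrix.diagonal fun j => (q j ⬝ᵥ q j)⁻¹) = 1 := by
    ext i j
    rw [← Matrix.mul_assoc, Matrix.mul_diagonal]
    change q i ⬝ᵥ q j * _ = _
    by_cases hij : i = j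
    · subst hij
      rw [mul_inv_cancel₀ (h.normSq_pos i).ne', Matrix.one_apply_eq]
    · rw [h.orth i j hij, zero_mul, Matrix.one_apply_ne hij]
  have h2 : (Matrix.of q)ᵀ *ᵥ ((Matrix.diagonal fun j => (q j ⬝ᵥ q j)⁻¹) *ᵥ (Matrix.of q *ᵥ v)) =
      v := by
    rw [Matrix.mulVec_mulVec, Matrix.mulVec_mulVec, mul_eq_one_comm.1 h1,
      Matrix.one_mulVec]
  conv_lhs => rw [← h2]
  ext i
  rw [Matrix.mulVec, dotProduct, Finset.sum_apply]
  refine Finset.sum_congr rfl fun j _ => ?_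
  rw [Matrix.mulVec_diagonal]
  change q j i * ((q j ⬝ᵥ q j)⁻¹ * (q j ⬝ᵥ v)) = (q j ⬝ᵥ v) / (q j ⬝ᵥ q j) * q j i
  ring

lemma ext (h : O.IsEigenbasis q lam z) {u v : Fin n → ℝ} (huv : ∀ j, q j ⬝ᵥ u = q j ⬝ᵥ v) :
    u = v := by
  rw [h.expansion u, h.expansion v]
  simp [huv]

lemma dotProduct_eq_sum (h : O.IsEigenbasis q lam z) (u v : Fin n → ℝ) :
    u ⬝ᵥ v = ∑ j, (q j ⬝ᵥ u) * (q j ⬝ᵥ v) / (q j ⬝ᵥ q j) := by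
  nth_rewrite 1 [h.expansion u]
  rw [sum_dotProduct]
  refine Finset.sum_congr rfl fun j _ => ?_
  rw [smul_dotProduct, smul_eq_mul]
  ring

lemma dotProduct_sum_smul (h : O.IsEigenbasis q lam z) (γ : Fin n → ℝ) (k : Fin n) :
    q k ⬝ᵥ ∑ j, γ j • q j = γ k * (q k ⬝ᵥ q k) := by
  rw [dotProduct_sum, Finset.sum_eq_single k]
  · rw [dotProduct_smul, smul_eq_mul]
  · intro j _ hj
    rw [dotProduct_smul, h.orth k j hj.symm, smul_zero]
  · simp

lemma lam_nonneg (h : O.IsEigenbasis q lam z) (j : Fin n) : 0 ≤ lam j := by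
  have h1 := O.dotProduct_laplacian_mulVec_nonneg (q j)
  rw [h.eig, dotProduct_smul, smul_eq_mul] at h1
  exact nonneg_of_mul_nonneg_left h1 (h.normSq_pos j)

lemma lam_first (h : O.IsEigenbasis q lam z) : lam z = 0 := by
  have h1 := congrFun (h.eig z) z
  rw [laplacian_mulVec, h.first] at h1
  simpa using h1.symm

lemma response_pos (h : O.IsEigenbasis q lam z) (j : Fin n) : 0 < 1 + O.β * lam j := by
  have := mul_nonneg O.β_nonneg (h.lam_nonneg j)
  linarith

lemma dotProduct_add_laplacian (h : O.IsEigenbasis q lam z) (a : Fin n → ℝ) (j : Fin n) :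
    q j ⬝ᵥ (a + O.β • (O.laplacian *ᵥ a)) = (1 + O.β * lam j) * (q j ⬝ᵥ a) := by
  rw [dotProduct_add, dotProduct_smul, dotProduct_laplacian_mulVec, h.eig, smul_dotProduct,
    smul_eq_mul, smul_eq_mul]
  ring

lemma add_laplacian_eq_iff (h : O.IsEigenbasis q lam z) (a y : Fin n → ℝ) :
    a + O.β • (O.laplacian *ᵥ a) = y ↔ ∀ j, q j ⬝ᵥ a = (q j ⬝ᵥ y) / (1 + O.β * lam j) := by
  constructor
  · rintro rfl j
    rw [h.dotProduct_add_laplacian, mul_div_cancel_left₀ _ (h.response_pos j).ne']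
  · intro hj
    refine h.ext fun j => ?_
    rw [h.dotProduct_add_laplacian, hj, mul_div_cancel₀ _ (h.response_pos j).ne']

/-- For the complete graph the synergy sum is `2n|a|² - 2(∑ a i)²`. Since `|q z|² = n`, the
subtracted square cancels exactly the cost along `q z`, and every other direction costs `2βn`. -/
lemma principalPayoff_eq (h : O.IsEigenbasis q lam z)
    (hcomplete : ∀ i j, i ≠ j → O.synergy i j = 1) (a x : Fin n → ℝ) :
    O.principalPayoff a x = -(x ⬝ᵥ x) + ∑ j, (2 * ((q j ⬝ᵥ a) * (q j ⬝ᵥ x)) -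
      (1 + if j = z then 0 else 2 * O.β * n) * (q j ⬝ᵥ a) ^ 2) / (q j ⬝ᵥ q j) := by
  have hn : (n : ℝ) ≠ 0 := by rw [← h.normSq_first]; exact (h.normSq_pos z).ne'
  have h1 : ∑ i, ∑ j, O.synergy i j * (a i - a j) ^ 2 =
      2 * (n * (a ⬝ᵥ a)) - 2 * (q z ⬝ᵥ a) ^ 2 := by
    have h2 : ∀ i j, O.synergy i j * (a i - a j) ^ 2 =
        a i * a i + a j * a j - 2 * (a i * a j) := by
      intro i j
      by_cases hij : i = j
      · subst hij; rw [O.synergy_diag]; ring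
      · rw [hcomplete i j hij]; ring
    have h3 : q z ⬝ᵥ a = ∑ i, a i := by simp [h.first, dotProduct]
    rw [h3, dotProduct]
    simp only [h2, Finset.sum_sub_distrib, Finset.sum_add_distrib, ← Finset.mul_sum,
      ← Finset.sum_mul, Finset.sum_const, Finset.card_univ, Fintype.card_fin, nsmul_eq_mul]
    have h5 : ∑ i, a i * (n * a i) = n * ∑ i, a i * a i := by
      rw [Finset.mul_sum]
      exact Finset.sum_congr rfl fun i _ => by ring
    rw [h5]
    ring
  have h4 : ∑ i, (a i - x i) ^ 2 = a ⬝ᵥ a - 2 * (a ⬝ᵥ x) + x ⬝ᵥ x := by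
    simp only [dotProduct, Finset.mul_sum, ← Finset.sum_sub_distrib, ← Finset.sum_add_distrib]
    exact Finset.sum_congr rfl fun i _ => by ring
  have h5 : ∀ j, (2 * ((q j ⬝ᵥ a) * (q j ⬝ᵥ x)) -
      (1 + if j = z then 0 else 2 * O.β * n) * (q j ⬝ᵥ a) ^ 2) / (q j ⬝ᵥ q j) =
      2 * ((q j ⬝ᵥ a) * (q j ⬝ᵥ x) / (q j ⬝ᵥ q j)) -
        (1 + 2 * O.β * n) * ((q j ⬝ᵥ a) * (q j ⬝ᵥ a) / (q j ⬝ᵥ q j)) +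
          if j = z then 2 * O.β * (q z ⬝ᵥ a) ^ 2 else 0 := by
    intro j
    split_ifs with hj
    · subst hj
      rw [h.normSq_first]
      field_simp
      ring
    · ring
  simp only [principalPayoff, h1, h4, h5]
  rw [Finset.sum_add_distrib, Finset.sum_sub_distrib, ← Finset.mul_sum, ← Finset.mul_sum,
    ← h.dotProduct_eq_sum, ← h.dotProduct_eq_sum, Finset.sum_ite_eq' Finset.univ z]
  simp
  ring

end IsEigenbasis

/-- The marginal value to the principal of disclosing the `j`-th statistic, up to the positive
factor `(q j ⬝ᵥ q j)⁻¹`. -/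
noncomputable def weight (lam : Fin n → ℝ) (z j : Fin n) : ℝ :=
  (2 * (1 + O.β * lam j) - (1 + if j = z then 0 else 2 * O.β * n)) / (1 + O.β * lam j) ^ 2

namespace IsEigenbasis

variable {O} {q : Fin n → Fin n → ℝ} {lam : Fin n → ℝ} {z : Fin n}

lemma weight_first (h : O.IsEigenbasis q lam z) : O.weight lam z z = 1 := by
  simp [weight, h.lam_first]
  norm_num

/-- The numerator is `1 - 2β(n - λ_j)`. The case `β = 0` is listed apart because it stands for `1/β
= ∞`, whereas `O.β⁻¹` is then `0`. -/
lemma weight_nonneg_iff (h : O.IsEigenbasis q lam z) {j : Fin n} (hj : j ≠ z) :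
    0 ≤ O.weight lam z j ↔ O.β = 0 ∨ O.β⁻¹ ≥ 2 * ((n : ℝ) - lam j) := by
  rw [weight, if_neg hj, le_div_iff₀ (pow_pos (h.response_pos j) 2), zero_mul]
  rcases O.β_nonneg.eq_or_lt with hβ | hβ
  · simp [← hβ]
  · rw [or_iff_right hβ.ne', ge_iff_le, inv_eq_one_div, le_div_iff₀ hβ]
    constructor <;> intro <;> linarith

lemma weight_pos_iff (h : O.IsEigenbasis q lam z) {j : Fin n} (hj : j ≠ z) :
    0 < O.weight lam z j ↔ O.β = 0 ∨ O.β⁻¹ > 2 * ((n : ℝ) - lam j) := by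
  rw [weight, if_neg hj, lt_div_iff₀ (pow_pos (h.response_pos j) 2), zero_mul]
  rcases O.β_nonneg.eq_or_lt with hβ | hβ
  · simp [← hβ]
  · rw [or_iff_right hβ.ne', gt_iff_lt, inv_eq_one_div, lt_div_iff₀ hβ]
    constructor <;> intro <;> linarith

/-! ### The principal's payoff as a weighted sum of second moments -/

section Value

variable {M : Type u} [MeasurableSpace M] (φ : Kernel (Fin n → ℝ) M) [IsMarkovKernel φ]

lemma isEquilibrium_iff (h : O.IsEigenbasis q lam z) (s : M → Fin n → ℝ) :
    O.IsEquilibrium φ s ↔ Measurable s ∧ ∀ᵐ m ∂O.signalLaw φ,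
      ∀ j, q j ⬝ᵥ s m = (q j ⬝ᵥ O.posteriorMean φ m) / (1 + O.β * lam j) := by
  rw [Organization.isEquilibrium_iff]
  simp only [h.add_laplacian_eq_iff]

lemma exists_isEquilibrium (h : O.IsEigenbasis q lam z) : ∃ s, O.IsEquilibrium φ s := by
  refine ⟨fun m => ∑ j, ((q j ⬝ᵥ O.posteriorMean φ m) / (1 + O.β * lam j) / (q j ⬝ᵥ q j)) • q j,
    (h.isEquilibrium_iff φ _).2 ⟨?_, .of_forall fun m j => ?_⟩⟩
  · refine measurable_pi_lambda _ fun i => ?_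
    simp only [Finset.sum_apply, Pi.smul_apply, smul_eq_mul]
    refine Finset.measurable_fun_sum _ fun j _ => Measurable.mul_const ?_ _
    exact (((measurable_dotProduct_left (q j)).comp (O.measurable_posteriorMean φ)).div_const
      _).div_const _
  · rw [h.dotProduct_sum_smul, div_mul_cancel₀ _ (h.normSq_pos j).ne']

/-- The projection property replaces each cross moment of estimate and state by the second moment of
the estimate; the cross and quadratic coefficients then merge into `weight`. -/
lemma value_eq (h : O.IsEigenbasis q lam z) (hcomplete : ∀ i j, i ≠ j → O.synergy i j = 1)
    {s : M → Fin n → ℝ} (hs : O.IsEquilibrium φ s) :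
    O.value φ s = -∫ x, x ⬝ᵥ x ∂O.prior + ∑ j, O.weight lam z j / (q j ⬝ᵥ q j) *
      ∫ p, (q j ⬝ᵥ O.posteriorMean φ p.2) ^ 2 ∂O.joint φ := by
  have hs' := (O.measurePreserving_snd_joint φ).quasiMeasurePreserving.ae
    ((h.isEquilibrium_iff φ s).1 hs).2
  have h1 : ∀ᵐ p ∂O.joint φ, O.principalPayoff (s p.2) p.1 = -(p.1 ⬝ᵥ p.1) +
      ∑ j, (2 / (1 + O.β * lam j) / (q j ⬝ᵥ q j) *
          ((q j ⬝ᵥ O.posteriorMean φ p.2) * (q j ⬝ᵥ p.1)) -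
        (1 + if j = z then 0 else 2 * O.β * n) / (1 + O.β * lam j) ^ 2 / (q j ⬝ᵥ q j) *
          (q j ⬝ᵥ O.posteriorMean φ p.2) ^ 2) := by
    filter_upwards [hs'] with p hp
    rw [h.principalPayoff_eq hcomplete]
    congr 1
    refine Finset.sum_congr rfl fun j _ => ?_
    rw [hp j]
    have := (h.response_pos j).ne'
    have := (h.normSq_pos j).ne'
    field_simp
  have i0 : Integrable (fun x : Fin n → ℝ => x ⬝ᵥ x) O.prior := by
    unfold dotProduct
    exact integrable_finsetSum _ fun i _ => (O.memLp_coord_prior i).integrable_mul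
      (O.memLp_coord_prior i)
  have i1 : Integrable (fun p : (Fin n → ℝ) × M => p.1 ⬝ᵥ p.1) (O.joint φ) :=
    (O.measurePreserving_fst_joint φ).integrable_comp_of_integrable i0
  have i2 : ∀ j, Integrable (fun p : (Fin n → ℝ) × M =>
      (q j ⬝ᵥ O.posteriorMean φ p.2) * (q j ⬝ᵥ p.1)) (O.joint φ) := fun j =>
    (O.memLp_estimate φ (q j)).integrable_mul (O.memLp_state φ (q j))
  have i3 : ∀ j, Integrable (fun p : (Fin n → ℝ) × M =>
      (q j ⬝ᵥ O.posteriorMean φ p.2) ^ 2) (O.joint φ) := fun j =>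
    (O.memLp_estimate φ (q j)).integrable_sq
  have e0 : ∫ p : (Fin n → ℝ) × M, p.1 ⬝ᵥ p.1 ∂O.joint φ = ∫ x, x ⬝ᵥ x ∂O.prior := by
    have hmp := O.measurePreserving_fst_joint φ
    have hi := i0.1
    rw [← hmp.map_eq] at hi ⊢
    exact (integral_map measurable_fst.aemeasurable hi).symm
  rw [value, integral_congr_ae h1, integral_add (by exact i1.neg)
    (integrable_finsetSum _ fun j _ => by exact ((i2 j).const_mul _).sub ((i3 j).const_mul _)),
    integral_neg, e0, integral_finsetSum _
    fun j _ => by exact ((i2 j).const_mul _).sub ((i3 j).const_mul _)]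
  congr 1
  refine Finset.sum_congr rfl fun j _ => ?_
  rw [integral_sub ((i2 j).const_mul _) ((i3 j).const_mul _), integral_const_mul,
    integral_const_mul, O.integral_estimate_mul_state]
  simp_rw [← pow_two]
  rw [← sub_mul, weight]
  have := (h.response_pos j).ne'
  have := (h.normSq_pos j).ne'
  congr 1
  field_simp

end Value

end IsEigenbasis

/-- The expected payoff of the principal when exactly the statistics of nonnegative weight are
disclosed. -/
noncomputable def optimalPayoff (q : Fin n → Fin n → ℝ) (lam : Fin n → ℝ) (z : Fin n) : ℝ :=
  -∫ x, x ⬝ᵥ x ∂O.prior +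
    ∑ j, max (O.weight lam z j) 0 / (q j ⬝ᵥ q j) * ∫ x, (q j ⬝ᵥ x) ^ 2 ∂O.prior

lemma integral_sq_state {M : Type u} [MeasurableSpace M] (φ : Kernel (Fin n → ℝ) M)
    [IsMarkovKernel φ] (c : Fin n → ℝ) :
    ∫ p, (c ⬝ᵥ p.1) ^ 2 ∂O.joint φ = ∫ x, (c ⬝ᵥ x) ^ 2 ∂O.prior := by
  rw [← (O.measurePreserving_fst_joint φ).map_eq, integral_map measurable_fst.aemeasurable]
  exact ((measurable_dotProduct_left c).pow_const 2).aestronglyMeasurable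

/-! ### The upper bound on the payoff and its equality case -/

namespace IsEigenbasis

variable {O} {q : Fin n → Fin n → ℝ} {lam : Fin n → ℝ} {z : Fin n}

lemma integral_sq_prior_pos (h : O.IsEigenbasis q lam z) (j : Fin n) :
    0 < ∫ x, (q j ⬝ᵥ x) ^ 2 ∂O.prior := by
  simp_rw [pow_two]
  rw [O.integral_dotProduct_mul_dotProduct_prior]
  have h1 : 0 < (O.σ : ℝ) ^ 2 * (q j ⬝ᵥ q j) :=
    mul_pos (pow_pos (NNReal.coe_pos.2 O.σ_pos) 2) (h.normSq_pos j)
  have h2 : 0 ≤ O.μ ^ 2 * (q j ⬝ᵥ 1) * (q j ⬝ᵥ 1) := by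
    rw [mul_assoc]
    exact mul_nonneg (sq_nonneg _) (mul_self_nonneg _)
  linarith

section

variable {M : Type u} [MeasurableSpace M] (φ : Kernel (Fin n → ℝ) M) [IsMarkovKernel φ]

lemma weight_mul_le (h : O.IsEigenbasis q lam z) (j : Fin n) :
    O.weight lam z j / (q j ⬝ᵥ q j) * ∫ p, (q j ⬝ᵥ O.posteriorMean φ p.2) ^ 2 ∂O.joint φ ≤
      max (O.weight lam z j) 0 / (q j ⬝ᵥ q j) * ∫ x, (q j ⬝ᵥ x) ^ 2 ∂O.prior := by
  rw [← O.integral_sq_state φ]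
  refine mul_le_mul ?_ (O.integral_sq_estimate_le φ (q j))
    (integral_nonneg fun p => sq_nonneg _) (div_nonneg (le_max_right _ _) (h.normSq_pos j).le)
  exact div_le_div_of_nonneg_right (le_max_left _ _) (h.normSq_pos j).le

/-- At weight zero both sides vanish whatever the signal does, which is where optimal signals fail
to be unique. -/
lemma weight_mul_eq_iff (h : O.IsEigenbasis q lam z) (j : Fin n) :
    O.weight lam z j / (q j ⬝ᵥ q j) * ∫ p, (q j ⬝ᵥ O.posteriorMean φ p.2) ^ 2 ∂O.joint φ =
      max (O.weight lam z j) 0 / (q j ⬝ᵥ q j) * ∫ x, (q j ⬝ᵥ x) ^ 2 ∂O.prior ↔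
    (0 < O.weight lam z j → ∀ᵐ p ∂O.joint φ, q j ⬝ᵥ O.posteriorMean φ p.2 = q j ⬝ᵥ p.1) ∧
    (O.weight lam z j < 0 → ∀ᵐ p ∂O.joint φ, q j ⬝ᵥ O.posteriorMean φ p.2 = 0) := by
  rw [estimate_eq_state_iff, estimate_eq_zero_iff, ← O.integral_sq_state φ]
  have hN := (h.normSq_pos j).ne'
  rcases lt_trichotomy (O.weight lam z j) 0 with hw | hw | hw
  · rw [max_eq_right hw.le]
    simp [hw, hw.not_gt, hw.ne, hN]
  · simp [hw]
  · rw [max_eq_left hw.le]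
    simp [hw, hw.not_gt, hw.ne', hN]

lemma value_le (h : O.IsEigenbasis q lam z) (hcomplete : ∀ i j, i ≠ j → O.synergy i j = 1)
    {s : M → Fin n → ℝ} (hs : O.IsEquilibrium φ s) :
    O.value φ s ≤ O.optimalPayoff q lam z := by
  rw [h.value_eq φ hcomplete hs, optimalPayoff]
  exact add_le_add_right (Finset.sum_le_sum fun j _ => h.weight_mul_le φ j) _

lemma value_eq_optimalPayoff_iff (h : O.IsEigenbasis q lam z)
    (hcomplete : ∀ i j, i ≠ j → O.synergy i j = 1) {s : M → Fin n → ℝ}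
    (hs : O.IsEquilibrium φ s) :
    O.value φ s = O.optimalPayoff q lam z ↔ ∀ j,
      (0 < O.weight lam z j → ∀ᵐ p ∂O.joint φ, q j ⬝ᵥ O.posteriorMean φ p.2 = q j ⬝ᵥ p.1) ∧
      (O.weight lam z j < 0 → ∀ᵐ p ∂O.joint φ, q j ⬝ᵥ O.posteriorMean φ p.2 = 0) := by
  rw [h.value_eq φ hcomplete hs, optimalPayoff, add_right_inj,
    Finset.sum_eq_sum_iff_of_le fun j _ => h.weight_mul_le φ j]
  simp only [Finset.mem_univ, true_imp_iff]
  exact forall_congr' (h.weight_mul_eq_iff φ)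

end

/-! ### Disclosing a set of basic statistics -/

section

variable {N : Type u} [MeasurableSpace N] {S : Set (Fin n)} {u : (S → ℝ) → N} {e : N → S → ℝ}
  {g : (Fin n → ℝ) → N}

/-- The estimates of the basic statistics under a signal that carries the same information as the
statistics in `S`. -/
lemma estimate_of_discloses (h : O.IsEigenbasis q lam z) (hz : z ∈ S) (hg : Measurable g)
    (hu : Measurable u) (he : Measurable e) (hgu : ∀ x, g x = u fun j => q j ⬝ᵥ x)
    (heg : ∀ x j, e (g x) j = q j ⬝ᵥ x) (k : Fin n) :
    (k ∈ S → ∀ᵐ p ∂O.joint (Kernel.deterministic g hg),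
      q k ⬝ᵥ O.posteriorMean (Kernel.deterministic g hg) p.2 = q k ⬝ᵥ p.1) ∧
    (k ∉ S → ∀ᵐ p ∂O.joint (Kernel.deterministic g hg),
      q k ⬝ᵥ O.posteriorMean (Kernel.deterministic g hg) p.2 = 0) := by
  constructor
  · intro hk
    exact O.estimate_deterministic_eq_state hg (q k)
      ((measurable_pi_apply (⟨k, hk⟩ : S)).comp he) fun x => heg x ⟨k, hk⟩
  · intro hk
    -- Since `z ∈ S`, an index outside `S` differs from `z`, so its statistic is centred.
    refine O.estimate_deterministic_eq_zero hg (q k) ?_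
      (h.dotProduct_one fun hkz => hk (hkz ▸ hz))
    have h1 := (O.indepFun_statistics (fun j : S => q j) (q k) fun j =>
      h.orth j k fun hjk => hk (hjk ▸ j.2)).comp hu measurable_id
    have h2 : g = u ∘ fun x j => q j ⬝ᵥ x := funext hgu
    rw [h2]
    exact h1

lemma estimate_discloseStatistics (h : O.IsEigenbasis q lam z) (hz : z ∈ S) (k : Fin n) :
    (k ∈ S → ∀ᵐ p ∂O.joint (discloseStatistics q S),
      q k ⬝ᵥ O.posteriorMean (discloseStatistics q S) p.2 = q k ⬝ᵥ p.1) ∧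
    (k ∉ S → ∀ᵐ p ∂O.joint (discloseStatistics q S),
      q k ⬝ᵥ O.posteriorMean (discloseStatistics q S) p.2 = 0) :=
  h.estimate_of_discloses hz _ measurable_id measurable_id (fun _ => rfl) (fun _ _ => rfl) k

end

lemma mem_disclosed_iff (h : O.IsEigenbasis q lam z) (j : Fin n) :
    (j = z ∨ O.β = 0 ∨ O.β⁻¹ ≥ 2 * ((n : ℝ) - lam j)) ↔ 0 ≤ O.weight lam z j := by
  by_cases hj : j = z
  · subst hj
    simp [h.weight_first]
  · rw [h.weight_nonneg_iff hj, or_iff_right hj]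

/-- Some signal with realizations in any given universe attains the optimal payoff and informs of
all statistics of nonnegative weight. -/
lemma exists_disclosure (h : O.IsEigenbasis q lam z) :
    ∃ (N : Type v) (_ : MeasurableSpace N) (ψ : Kernel (Fin n → ℝ) N) (_ : IsMarkovKernel ψ), ∀ k,
      (0 ≤ O.weight lam z k →
        ∀ᵐ p ∂O.joint ψ, q k ⬝ᵥ O.posteriorMean ψ p.2 = q k ⬝ᵥ p.1) ∧
      (O.weight lam z k < 0 → ∀ᵐ p ∂O.joint ψ, q k ⬝ᵥ O.posteriorMean ψ p.2 = 0) := by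
  let S : Set (Fin n) := {j | 0 ≤ O.weight lam z j}
  have hstat : Measurable fun (x : Fin n → ℝ) (j : S) => q j ⬝ᵥ x :=
    measurable_pi_lambda _ fun j => measurable_dotProduct_left (q j)
  have hg : Measurable fun x : Fin n → ℝ => ULift.up.{v} fun j : S => q j ⬝ᵥ x :=
    measurable_up.comp hstat
  -- Optimality quantifies over competitors in universe `v`, so the realizations are lifted there.
  refine ⟨ULift.{v} (S → ℝ), inferInstance, Kernel.deterministic _ hg, inferInstance, fun k => ?_⟩
  have h1 := h.estimate_of_discloses (S := S) (by simp [S, h.weight_first]) hg measurable_up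
    measurable_down (fun _ => rfl) (fun _ _ => rfl) k
  exact ⟨h1.1, fun hk => h1.2 (not_le.2 hk)⟩

/-! ### Characterization of optimal and maximal signals -/

section

variable {M : Type u} [MeasurableSpace M] (φ : Kernel (Fin n → ℝ) M) [IsMarkovKernel φ]

/-- A signal is optimal if and only if it informs of all statistics of positive weight and its
posterior expectations of the statistics of negative weight are trivial. -/
lemma isOptimal_iff (h : O.IsEigenbasis q lam z)
    (hcomplete : ∀ i j, i ≠ j → O.synergy i j = 1) :
    IsOptimal.{u, v} O φ ↔ ∀ j,
      (0 < O.weight lam z j → ∀ᵐ p ∂O.joint φ, q j ⬝ᵥ O.posteriorMean φ p.2 = q j ⬝ᵥ p.1) ∧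
      (O.weight lam z j < 0 → ∀ᵐ p ∂O.joint φ, q j ⬝ᵥ O.posteriorMean φ p.2 = 0) := by
  constructor
  · rintro ⟨s, hs, hopt⟩
    rw [← h.value_eq_optimalPayoff_iff φ hcomplete hs]
    obtain ⟨N, _, ψ, _, hψ⟩ := h.exists_disclosure
    obtain ⟨t, ht⟩ := h.exists_isEquilibrium ψ
    refine le_antisymm (h.value_le φ hcomplete hs) ?_
    rw [← (h.value_eq_optimalPayoff_iff ψ hcomplete ht).2 fun j =>
      ⟨fun hj => (hψ j).1 hj.le, (hψ j).2⟩]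
    exact hopt N ψ t ht
  · intro hj
    obtain ⟨s, hs⟩ := h.exists_isEquilibrium φ
    refine ⟨s, hs, fun N _ ψ _ t ht => ?_⟩
    rw [(h.value_eq_optimalPayoff_iff φ hcomplete hs).2 hj]
    exact h.value_le ψ hcomplete ht

/-- The posterior estimate and the state cannot both agree with a basic statistic and vanish. -/
lemma not_informs_of_estimate_eq_zero (h : O.IsEigenbasis q lam z) {j : Fin n}
    (h0 : ∀ᵐ p ∂O.joint φ, q j ⬝ᵥ O.posteriorMean φ p.2 = 0) :
    ¬ O.Informs φ fun x => q j ⬝ᵥ x := by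
  intro hinf
  rw [informs_dotProduct_iff, estimate_eq_state_iff, (O.estimate_eq_zero_iff φ (q j)).1 h0,
    O.integral_sq_state φ] at hinf
  exact (h.integral_sq_prior_pos j).ne hinf

/-- An informed linear statistic has no component along a basic statistic whose estimate is
trivial. -/
lemma dotProduct_eq_zero_of_informs (h : O.IsEigenbasis q lam z) {k : Fin n} (hk : k ≠ z)
    (h0 : ∀ᵐ p ∂O.joint φ, q k ⬝ᵥ O.posteriorMean φ p.2 = 0) {c : Fin n → ℝ}
    (hc : O.Informs φ fun x => c ⬝ᵥ x) : q k ⬝ᵥ c = 0 := by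
  rw [informs_dotProduct_iff] at hc
  -- The moment `E[(c ⬝ᵥ x̂)(q k ⬝ᵥ x)]` is computed twice: projection and `h0` make it zero, while
  -- `c ⬝ᵥ x̂ = c ⬝ᵥ x` makes it `σ² (c ⬝ᵥ q k)`, the mean term dropping out because `k ≠ z`.
  have h1 := O.integral_estimate_mul_state φ c (q k)
  have h2 : ∫ p, (c ⬝ᵥ O.posteriorMean φ p.2) * (q k ⬝ᵥ O.posteriorMean φ p.2) ∂O.joint φ = 0 := by
    rw [integral_congr_ae (g := fun _ => (0 : ℝ)) (by filter_upwards [h0] with p hp; simp [hp]),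
      integral_zero]
  have h3 : ∫ p, (c ⬝ᵥ O.posteriorMean φ p.2) * (q k ⬝ᵥ p.1) ∂O.joint φ =
      ∫ p, (c ⬝ᵥ p.1) * (q k ⬝ᵥ p.1) ∂O.joint φ :=
    integral_congr_ae (by filter_upwards [hc] with p hp; rw [hp])
  rw [h2, h3, O.integral_state_mul_state, h.dotProduct_one hk, mul_zero, add_zero] at h1
  rw [dotProduct_comm]
  exact (mul_eq_zero.1 h1).resolve_left (pow_ne_zero 2 (NNReal.coe_pos.2 O.σ_pos).ne')

lemma ne_first_of_weight_neg (h : O.IsEigenbasis q lam z) {k : Fin n}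
    (hk : O.weight lam z k < 0) : k ≠ z := by
  rintro rfl
  rw [h.weight_first] at hk
  linarith

/-- An optimal signal that informs of all statistics of nonnegative weight is maximal. -/
lemma isMaximalOptimal_of_informs (h : O.IsEigenbasis q lam z)
    (hcomplete : ∀ i j, i ≠ j → O.synergy i j = 1) (hopt : IsOptimal.{u, v} O φ)
    (hφ : ∀ j, 0 ≤ O.weight lam z j → O.Informs φ fun x => q j ⬝ᵥ x) :
    IsMaximalOptimal.{u, v} O φ := by
  refine ⟨hopt, fun N _ ψ _ hψ c hc => ?_⟩
  rw [h.isOptimal_iff ψ hcomplete] at hψ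
  simp only [informs_dotProduct_iff] at hφ ⊢
  have h1 : ∀ᵐ p ∂O.joint φ, ∀ j, 0 ≤ O.weight lam z j →
      q j ⬝ᵥ O.posteriorMean φ p.2 = q j ⬝ᵥ p.1 := by
    rw [ae_all_iff]
    intro j
    by_cases hj : 0 ≤ O.weight lam z j
    · filter_upwards [hφ j hj] with p hp _ using hp
    · exact .of_forall fun p hj' => absurd hj' hj
  filter_upwards [h1] with p hp
  rw [h.dotProduct_eq_sum, h.dotProduct_eq_sum c]
  refine Finset.sum_congr rfl fun j _ => ?_
  rcases le_or_gt 0 (O.weight lam z j) with hj | hj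
  · rw [hp j hj]
  · rw [h.dotProduct_eq_zero_of_informs ψ (h.ne_first_of_weight_neg hj) ((hψ j).2 hj) hc]
    simp

lemma informs_of_isMaximalOptimal (h : O.IsEigenbasis q lam z)
    (hcomplete : ∀ i j, i ≠ j → O.synergy i j = 1) (hmax : IsMaximalOptimal.{u, v} O φ) {j : Fin n}
    (hj : 0 ≤ O.weight lam z j) : O.Informs φ fun x => q j ⬝ᵥ x := by
  obtain ⟨N, _, ψ, _, hψ⟩ := h.exists_disclosure
  refine hmax.2 N ψ ((h.isOptimal_iff ψ hcomplete).2 fun k =>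
    ⟨fun hk => (hψ k).1 hk.le, (hψ k).2⟩) (q j) ?_
  rw [informs_dotProduct_iff]
  exact (hψ j).1 hj

lemma weight_nonneg_of_informs (h : O.IsEigenbasis q lam z)
    (hcomplete : ∀ i j, i ≠ j → O.synergy i j = 1) (hopt : IsOptimal.{u, v} O φ) {j : Fin n}
    (hj : O.Informs φ fun x => q j ⬝ᵥ x) : 0 ≤ O.weight lam z j := by
  by_contra! hw
  exact h.not_informs_of_estimate_eq_zero φ (((h.isOptimal_iff φ hcomplete).1 hopt j).2 hw) hj

/-- If every basic statistic is either disclosed by the signal or has a trivial estimate, then the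
posterior expectation is that given the disclosed statistics. -/
lemma posteriorMean_eq_discloseStatistics (h : O.IsEigenbasis q lam z) {S : Set (Fin n)}
    (hz : z ∈ S)
    (hS : ∀ j ∈ S, ∀ᵐ p ∂O.joint φ, q j ⬝ᵥ O.posteriorMean φ p.2 = q j ⬝ᵥ p.1)
    (hS' : ∀ j ∉ S, ∀ᵐ p ∂O.joint φ, q j ⬝ᵥ O.posteriorMean φ p.2 = 0) :
    ∀ᵐ p ∂O.joint φ, O.posteriorMean φ p.2 =
      O.posteriorMean (discloseStatistics q S) fun j => q j ⬝ᵥ p.1 := by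
  have hstat : Measurable fun (x : Fin n → ℝ) (j : S) => q j ⬝ᵥ x :=
    measurable_pi_lambda _ fun j => measurable_dotProduct_left (q j)
  -- The disclosure signal is a function of the state, and both joint laws have the prior as state
  -- marginal; almost sure facts thus transfer between the two signals.
  have hpull : ∀ {P : (Fin n → ℝ) × (S → ℝ) → Prop},
      (∀ᵐ p ∂O.joint (discloseStatistics q S), P p) →
        ∀ᵐ p ∂O.joint φ, P (p.1, fun j => q j ⬝ᵥ p.1) := by
    intro P hP
    have h1 : ∀ᵐ x ∂O.prior, P (x, fun j => q j ⬝ᵥ x) := by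
      have h2 := O.joint_deterministic hstat
      change O.joint (discloseStatistics q S) = _ at h2
      rw [h2] at hP
      exact ae_of_ae_map (measurable_id.prodMk hstat).aemeasurable hP
    exact (O.measurePreserving_fst_joint φ).quasiMeasurePreserving.ae h1
  have hall : ∀ᵐ p ∂O.joint φ, ∀ k, q k ⬝ᵥ O.posteriorMean φ p.2 =
      q k ⬝ᵥ O.posteriorMean (discloseStatistics q S) fun j => q j ⬝ᵥ p.1 := by
    rw [ae_all_iff]
    intro k
    have hk := h.estimate_discloseStatistics hz k
    by_cases hkS : k ∈ S
    · filter_upwards [hS k hkS, hpull (hk.1 hkS)] with p h1 h2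
      rw [h1, h2]
    · filter_upwards [hS' k hkS, hpull (hk.2 hkS)] with p h1 h2
      rw [h1, h2]
  filter_upwards [hall] with p hp using h.ext hp

end

end IsEigenbasis

end Organization

theorem proposition6 {n : ℕ} (hn : 0 < n) (O : Organization n)
    (hcomplete : ∀ i j, i ≠ j → O.synergy i j = 1)
    (q : Fin n → Fin n → ℝ) (lam : Fin n → ℝ)
    (hq_first : q ⟨0, hn⟩ = 1) (hq_ne : ∀ j, q j ≠ 0)
    (hq_orth : ∀ i j, i ≠ j → q i ⬝ᵥ q j = 0)
    (hq_eig : ∀ j, O.laplacian *ᵥ q j = lam j • q j) :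
    Organization.IsMaximalOptimal.{0, v} O
      (discloseStatistics q
        {j | j = ⟨0, hn⟩ ∨ O.β = 0 ∨ O.β⁻¹ ≥ 2 * ((n : ℝ) - lam j)}) ∧
    ∀ (M : Type u) [MeasurableSpace M] (φ : Kernel (Fin n → ℝ) M) [IsMarkovKernel φ],
      (Organization.IsOptimal.{u, v} O φ →
        O.Informs φ (fun x => q ⟨0, hn⟩ ⬝ᵥ x) ∧
        ∀ j, j ≠ ⟨0, hn⟩ →
          (O.Informs φ (fun x => q j ⬝ᵥ x) → O.β = 0 ∨ O.β⁻¹ ≥ 2 * ((n : ℝ) - lam j)) ∧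
          ((O.β = 0 ∨ O.β⁻¹ > 2 * ((n : ℝ) - lam j)) → O.Informs φ (fun x => q j ⬝ᵥ x))) ∧
      (Organization.IsMaximalOptimal.{u, v} O φ →
        (∀ j, j ≠ ⟨0, hn⟩ →
          (O.Informs φ (fun x => q j ⬝ᵥ x) ↔ O.β = 0 ∨ O.β⁻¹ ≥ 2 * ((n : ℝ) - lam j))) ∧
        ∀ᵐ p ∂(O.joint φ),
          O.posteriorMean φ p.2 =
            O.posteriorMean (discloseStatistics q {j | O.Informs φ (fun x => q j ⬝ᵥ x)})
              (fun j => q j ⬝ᵥ p.1)) := by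
  have h : O.IsEigenbasis q lam ⟨0, hn⟩ := ⟨hq_first, hq_ne, hq_orth, hq_eig⟩
  have hfirst : 0 < O.weight lam ⟨0, hn⟩ ⟨0, hn⟩ := by rw [h.weight_first]; exact one_pos
  refine ⟨?_, fun M _ φ _ => ⟨fun hopt => ⟨?_, fun j hj => ⟨fun hinf => ?_, fun hβ => ?_⟩⟩,
    fun hmax => ⟨fun j hj => ⟨fun hinf => ?_, fun hβ => ?_⟩, ?_⟩⟩⟩
  · have hd := fun k => h.estimate_discloseStatistics
      (S := {j | j = ⟨0, hn⟩ ∨ O.β = 0 ∨ O.β⁻¹ ≥ 2 * ((n : ℝ) - lam j)}) (Or.inl rfl) k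
    simp only [Set.mem_ofPred_eq, h.mem_disclosed_iff, not_le] at hd
    refine h.isMaximalOptimal_of_informs _ hcomplete
      ((h.isOptimal_iff _ hcomplete).2 fun j => ?_) fun j hj => ?_
    · exact ⟨fun hj => (hd j).1 hj.le, (hd j).2⟩
    · rw [Organization.informs_dotProduct_iff]
      exact (hd j).1 hj
  · rw [Organization.informs_dotProduct_iff]
    exact ((h.isOptimal_iff φ hcomplete).1 hopt _).1 hfirst
  · rw [← h.weight_nonneg_iff hj]
    exact h.weight_nonneg_of_informs φ hcomplete hopt hinf
  · rw [Organization.informs_dotProduct_iff]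
    exact ((h.isOptimal_iff φ hcomplete).1 hopt j).1 ((h.weight_pos_iff hj).2 hβ)
  · rw [← h.weight_nonneg_iff hj]
    exact h.weight_nonneg_of_informs φ hcomplete hmax.1 hinf
  · exact h.informs_of_isMaximalOptimal φ hcomplete hmax ((h.weight_nonneg_iff hj).2 hβ)
  · refine h.posteriorMean_eq_discloseStatistics φ
      (h.informs_of_isMaximalOptimal φ hcomplete hmax hfirst.le) (fun j hj => ?_) fun j hj => ?_
    · exact (O.informs_dotProduct_iff φ (q j)).1 hj
    -- A statistic of which a maximal signal does not inform must have negative weight, so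
    -- optimality makes its estimate vanish.
    · refine ((h.isOptimal_iff φ hcomplete).1 hmax.1 j).2 ?_
      by_contra! hw
      exact hj (h.informs_of_isMaximalOptimal φ hcomplete hmax hw)
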